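/- Let $K$ be a field of characteristic $0$; all vector spaces and Lie algebras are over $K$ and of arbitrary dimension. **Formal series.** For vector spaces $E,F$, let $F[E]_m$ be the space of homogeneous polynomials of degree $m$ from $E$ to $F$, i.e. of the maps $x\mapsto u(x,\dots,x)$ with $u:E^m\to F$ multilinear, and let $F[[E]]=\prod_{m\ge 0}F[E]_m$ be the space of formal series $f=\sum_m f_m$, $f_m\in F[E]_m$. If $\xi\in E[E]_r$ and $f\in F[E]_m$ is determined by $u$, put $(\xi.f)(x)=\sum_{i=1}^m u(x,\dots,\xi(x),\dots,x)$ ($\xi(x)$ in the $i$-th place); this is an element of $F[E]_{r+m-1}$ (it is $0$ if $m=0$) which does not depend on the choice of $u$. For $\xi\in E[[E]]$ and $f\in F[[E]]$ the derivative $\xi.f\in F[[E]]$ of $f$ along $\xi$ is defined by $(\xi.f)_k=\sum_{r+m=k+1}\xi_r.f_m$. **The wreath product.** Let $t_n$ be the coefficients of $\dfrac{Te^T}{e^T-1}=\sum_{n\ge0}t_nT^n$. Let $A,B$ be Lie algebras. The space $A[[B]]$ is a Lie algebra for the pointwise bracket $[f,g]_k(y)=\sum_{n+r=k}[f_n(y),g_r(y)]$.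 For $b\in B$ let $d_b\in B[[B]]$ be the series with components $d_{b,n}(y)=t_n(\operatorname{ad}y)^n(b)$. The maps $f\mapsto d_b.f$ are derivations of $A[[B]]$ and $b\mapsto(f\mapsto d_b.f)$ is a Lie algebra homomorphism from $B$ to the derivations of $A[[B]]$. The wreath product $W(A,B)=A[[B]]\rtimes B$ is the corresponding semidirect product, that is, the space $A[[B]]\times B$ with the bracket $$[(f,b),(g,c)]=([f,g]+d_b.g-d_c.f,\,[b,c]).$$ **Theorem.** Let $0\to A\to C\xrightarrow{\,p\,}B\to 0$ be an extension of Lie algebras (so $p$ is a surjective homomorphism, and $A$ is identified with its kernel) and let $s:B\to C$ be any linear section of $p$, i.e. a $K$-linear map with $p\circ s=\mathrm{id}_B$. For $c\in C$, $m\ge0$ and $y\in B$ put, with $R=\operatorname{ad}(s(y))$, $$h_{c,m}(y)=\frac1{m!}R^m c-\sum_{n+r=m}\frac{t_r}{(n+1)!}\,R^n\,s\,p\,R^r c .$$ Then $h_{c,m}(y)\in A$, each $h_{c,m}$ belongs to $A[B]_m$, and, with $h_c=\sum_m h_{c,m}\in A[[B]]$, the map $$f_s:C\to W(A,B),\qquad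 f_s(c)=(h_c,\,p(c)),$$ is an injective homomorphism of Lie algebras. -/

import Mathlib

namespace Entrelacement

open Finset.HasAntidiagonal (antidiagonal mem_antidiagonal)

section HomogeneousPolynomials

variable (K E F : Type*) [Field K] [AddCommGroup E] [Module K E] [AddCommGroup F] [Module K F]

/-- `F[E]_m`: the homogeneous polynomials of degree `m` with variables in `E` and coefficients
in `F`, i.e. the maps `x ↦ u (x, …, x)` with `u : E ^ m → F` multilinear. -/
def HomPoly (m : ℕ) : Submodule K (E → F) where
  carrier := {f | ∃ u : MultilinearMap K (fun _ : Fin m => E) F, ∀ x, f x = u fun _ => x}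
  add_mem' := by
    rintro f g ⟨u, hu⟩ ⟨v, hv⟩
    exact ⟨u + v, fun x => by simp [hu, hv]⟩
  zero_mem' := ⟨0, fun x => by simp⟩
  smul_mem' := by
    rintro a f ⟨u, hu⟩
    exact ⟨a • u, fun x => by simp [hu]⟩

/-- `F[[E]] = ∏_m F[E]_m`: the formal series with variables in `E` and coefficients in `F`. -/
abbrev FormalSeries : Type _ := (m : ℕ) → HomPoly K E F m

end HomogeneousPolynomials

section Basic

variable {K E F G : Type*} [Field K] [AddCommGroup E] [Module K E] [AddCommGroup F] [Module K F]
  [AddCommGroup G] [Module K G]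

theorem FormalSeries.ext {f g : FormalSeries K E F} (h : ∀ m x, (f m).1 x = (g m).1 x) : f = g :=
  funext fun m => Subtype.ext (funext fun x => h m x)

@[simp] theorem FormalSeries.add_coe (f g : FormalSeries K E F) (m : ℕ) (x : E) :
    ((f + g) m).1 x = (f m).1 x + (g m).1 x := rfl

@[simp] theorem FormalSeries.sub_coe (f g : FormalSeries K E F) (m : ℕ) (x : E) :
    ((f - g) m).1 x = (f m).1 x - (g m).1 x := rfl

@[simp] theorem FormalSeries.zero_coe (m : ℕ) (x : E) :
    ((0 : FormalSeries K E F) m).1 x = 0 := rfl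

@[simp] theorem FormalSeries.smul_coe (a : K) (f : FormalSeries K E F) (m : ℕ) (x : E) :
    ((a • f) m).1 x = a • (f m).1 x := rfl

/-- The derivative at the point `x` in the direction `v` of the homogeneous polynomial
determined by `u`, namely `∑ i, u (x, …, v, …, x)` with `v` at the place `i`; by `dirDeriv_eq`
below it does not depend on the multilinear map `u` which determines `f`. -/
noncomputable def dirDeriv {m : ℕ} (f : HomPoly K E F m) (x v : E) : F :=
  ∑ i, f.2.choose (Function.update (fun _ => x) i v)

theorem mem_of_multilinear {ι : Type*} [Fintype ι] {m : ℕ} (h : Fintype.card ι = m)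
    (u : MultilinearMap K (fun _ : ι => E) F) : (fun x => u fun _ => x) ∈ HomPoly K E F m :=
  ⟨u.domDomCongr (Fintype.equivFinOfCardEq h), fun x => by simp⟩

theorem comp_mem {m : ℕ} (u : MultilinearMap K (fun _ : Fin m => E) F) (n : Fin m → ℕ)
    (g : Fin m → G → E) (hg : ∀ i, g i ∈ HomPoly K G E (n i)) :
    (fun x => u fun i => g i x) ∈ HomPoly K G F (∑ i, n i) := by
  choose v hv using hg
  have := mem_of_multilinear (K := K) (ι := Σ i, Fin (n i))
    (m := ∑ i, n i) (by simp)
    (u.compMultilinearMap (N := fun _ _ => G) v)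
  refine (congrArg (· ∈ HomPoly K G F (∑ i, n i)) ?_).mp this
  funext x
  simp only [MultilinearMap.compMultilinearMap_apply, hv]
  rfl

theorem linear_mem (p : E →ₗ[K] F) : (fun x => p x) ∈ HomPoly K E F 1 :=
  ⟨MultilinearMap.ofSubsingleton K E F (0 : Fin 1) p, fun x => by simp⟩

theorem const_mem (a : F) : (fun _ => a) ∈ HomPoly K E F 0 :=
  ⟨MultilinearMap.constOfIsEmpty K (fun _ : Fin 0 => E) a, fun x => by simp⟩

theorem dirDeriv_mem {r m s : ℕ} (ξ : HomPoly K E E r) (f : HomPoly K E F m) (h : r + m = s + 1) :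
    (fun x => dirDeriv f x (ξ.1 x)) ∈ HomPoly K E F s := by
  have key : ∀ i : Fin m, (fun x => f.2.choose (Function.update (fun _ => x) i (ξ.1 x))) ∈
      HomPoly K E F s := by
    intro i
    have h1 := comp_mem f.2.choose (Function.update (fun _ => 1) i r)
      (Function.update (fun _ => fun x => x) i ξ.1) (by
        intro j
        by_cases hj : j = i
        · subst hj; simp
        · simpa [hj] using linear_mem (LinearMap.id (R := K) (M := E)))
    have h2 : ∑ j, Function.update (fun _ : Fin m => 1) i r j = s := by
      rw [Finset.sum_update_of_mem (Finset.mem_univ i)]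
      simp [Finset.card_sdiff]
      have := i.2
      omega
    rw [h2] at h1
    refine (congrArg (· ∈ HomPoly K E F s) ?_).mp h1
    funext x
    congr 1
    funext j
    by_cases hj : j = i
    · subst hj; simp
    · simp [hj]
  have := Submodule.sum_mem (HomPoly K E F s) (fun i (_ : i ∈ Finset.univ) => key i)
  refine (congrArg (· ∈ HomPoly K E F s) ?_).mp this
  funext x
  simp [dirDeriv]

/-- The derivative `ξ . f ∈ F[[E]]` of `f ∈ F[[E]]` along `ξ ∈ E[[E]]`: its component of degree `s`
is the sum of the derivatives `ξ_r . f_m`, `r + m - 1 = s`, where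
`(ξ_r . f_m) (x) = ∑ i, u (x, …, ξ_r (x), …, x)` when `u` determines `f_m`. -/
noncomputable def seriesDeriv (ξ : FormalSeries K E E) (f : FormalSeries K E F) :
    FormalSeries K E F := fun s =>
  ⟨fun x => ∑ p ∈ antidiagonal (s + 1), dirDeriv (f p.2) x ((ξ p.1).1 x), by
    have := Submodule.sum_mem (HomPoly K E F s)
      (fun p (hp : p ∈ antidiagonal (s + 1)) =>
        dirDeriv_mem (ξ p.1) (f p.2) (mem_antidiagonal.mp hp))
    refine (congrArg (· ∈ HomPoly K E F s) ?_).mp this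
    funext x
    simp⟩

theorem seriesDeriv_coe (ξ : FormalSeries K E E) (f : FormalSeries K E F) (s : ℕ) (x : E) :
    (seriesDeriv ξ f s).1 x =
      ∑ p ∈ antidiagonal (s + 1), dirDeriv (f p.2) x ((ξ p.1).1 x) := rfl

end Basic

section Curves

variable {K E F : Type*} [Field K] [AddCommGroup E] [Module K E] [AddCommGroup F] [Module K F]

/-- `γ` is a polynomial map of one variable with `γ t = a + t d + ⋯`. -/
def Curve (γ : K → F) (a d : F) : Prop :=
  ∃ (N : ℕ) (c : ℕ → F), c 0 = a ∧ c 1 = d ∧ ∀ t, γ t = ∑ k ∈ Finset.range (N + 2), t ^ k • c k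

theorem Curve.of_sum {ι : Type*} (S : Finset ι) (e : ι → ℕ) (v : ι → F) {γ : K → F}
    (h : ∀ t, γ t = ∑ i ∈ S, t ^ e i • v i) :
    Curve γ (∑ i ∈ S with e i = 0, v i) (∑ i ∈ S with e i = 1, v i) := by
  refine ⟨S.sup e, fun k => ∑ i ∈ S with e i = k, v i, rfl, rfl, fun t => ?_⟩
  rw [h, ← Finset.sum_fiberwise_of_maps_to (t := Finset.range (S.sup e + 2)) (g := e)]
  · refine Finset.sum_congr rfl fun k _ => ?_
    rw [Finset.smul_sum]
    refine Finset.sum_congr rfl fun i hi => ?_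
    rw [(Finset.mem_filter.mp hi).2]
  · intro i hi
    have := Finset.le_sup (f := e) hi
    simp; omega

theorem Curve.value {γ : K → F} {a d : F} (h : Curve γ a d) : γ 0 = a := by
  obtain ⟨N, c, rfl, rfl, h⟩ := h
  simp [h, Finset.sum_range_succ']

theorem Curve.unique [Infinite K] {γ : K → F} {a a' d d' : F} (h : Curve γ a d)
    (h' : Curve γ a' d') : d = d' := by
  obtain ⟨N, c, -, rfl, h⟩ := h
  obtain ⟨N', c', -, rfl, h'⟩ := h'
  rw [← sub_eq_zero, ← Module.forall_dual_apply_eq_zero_iff K]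
  intro φ
  have : ∑ k ∈ Finset.range (N + 2), Polynomial.monomial k (φ (c k)) =
      ∑ k ∈ Finset.range (N' + 2), Polynomial.monomial k (φ (c' k)) := by
    refine Polynomial.funext fun t => ?_
    have := congrArg φ ((h t).symm.trans (h' t))
    simpa [Polynomial.eval_finsetSum, mul_comm] using this
  have := congrArg (fun P => Polynomial.coeff P 1) this
  simp [Polynomial.coeff_monomial] at this
  simp [this]

theorem Curve.congr {γ γ' : K → F} {a a' d d' : F} (h : Curve γ a d) (hγ : γ = γ') (ha : a = a')
    (hd : d = d') : Curve γ' a' d' := by subst hγ ha hd; exact h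

theorem Curve.line (x v : E) : Curve (fun t : K => x + t • v) x v :=
  ⟨0, fun k => if k = 0 then x else v, by simp, by simp, fun t => by simp [Finset.sum_range_succ]⟩

theorem Curve.zero : Curve (fun _ : K => (0 : E)) 0 0 :=
  ⟨0, fun _ => 0, by simp, by simp, fun t => by simp⟩

theorem Curve.add {γ δ : K → F} {a a' d d' : F} (h : Curve γ a d) (h' : Curve δ a' d') :
    Curve (fun t => γ t + δ t) (a + a') (d + d') := by
  obtain ⟨N, c, rfl, rfl, h⟩ := h
  obtain ⟨N', c', rfl, rfl, h'⟩ := h'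
  have := Curve.of_sum (K := K) ((Finset.range (N + 2)).disjSum (Finset.range (N' + 2)))
    (Sum.elim id id) (Sum.elim c c') (γ := fun t => γ t + δ t) (by
      intro t; simp [Finset.sum_disjSum, h, h'])
  refine this.congr rfl ?_ ?_ <;>
  · rw [Finset.sum_filter, Finset.sum_disjSum]
    simp only [Sum.elim_inl, Sum.elim_inr, id]
    congr 1 <;>
    refine (Finset.sum_eq_single_of_mem _ ?_ (fun j _ hj => if_neg hj)).trans (if_pos rfl) <;>
    simp

theorem Curve.sum {ι : Type*} (S : Finset ι) {γ : ι → K → F} {a d : ι → F}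
    (h : ∀ i ∈ S, Curve (γ i) (a i) (d i)) :
    Curve (fun t => ∑ i ∈ S, γ i t) (∑ i ∈ S, a i) (∑ i ∈ S, d i) := by
  classical
  induction S using Finset.induction_on with
  | empty => simpa using Curve.zero
  | insert i S hi ih =>
    simp only [Finset.sum_insert hi]
    exact (h i (by simp)).add (ih fun j hj => h j (by simp [hj]))

theorem Curve.linear {γ : K → E} {a d : E} (h : Curve γ a d) (p : E →ₗ[K] F) :
    Curve (fun t => p (γ t)) (p a) (p d) := by
  obtain ⟨N, c, rfl, rfl, h⟩ := h
  exact ⟨N, fun k => p (c k), rfl, rfl, fun t => by simp [h]⟩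

theorem Curve.multilinear {m : ℕ} (u : MultilinearMap K (fun _ : Fin m => E) F)
    {γ : Fin m → K → E} {a d : Fin m → E} (h : ∀ i, Curve (γ i) (a i) (d i)) :
    Curve (fun t => u fun i => γ i t) (u a) (∑ i, u (Function.update a i (d i))) := by
  choose N c h0 h1 h using h
  have := Curve.of_sum (K := K) (Fintype.piFinset fun i => Finset.range (N i + 2))
    (fun r => ∑ i, r i) (fun r => u fun i => c i (r i)) (γ := fun t => u fun i => γ i t) (by
      intro t
      simp only [h]
      rw [MultilinearMap.map_sum_finset]
      refine Finset.sum_congr rfl fun r _ => ?_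
      rw [MultilinearMap.map_smul_univ, Finset.prod_pow_eq_pow_sum])
  refine this.congr rfl ?_ ?_
  · rw [Finset.sum_eq_single (fun _ => 0)]
    · simp [h0]
    · intro r hr hr'
      simp only [Finset.mem_filter, Finset.sum_eq_zero_iff, Finset.mem_univ, true_implies] at hr
      exact absurd (funext hr.2) hr'
    · intro hr
      simp at hr
  · symm
    refine Finset.sum_bij (fun i _ => Pi.single i 1) ?_ ?_ ?_ ?_
    · intro i _
      simp only [Finset.mem_filter, Fintype.mem_piFinset, Finset.mem_range]
      refine ⟨fun j => ?_, by simp⟩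
      by_cases hj : j = i
      · subst hj; simp
      · simp [hj]
    · intro i _ j _ hij
      by_contra hne
      have := congrFun hij i
      simp [hne] at this
    · intro r hr
      have hr1 := (Finset.mem_filter.mp hr).2
      have : ∃ i, r i ≠ 0 := by
        by_contra! hcon
        simp [hcon] at hr1
      obtain ⟨i, hi⟩ := this
      refine ⟨i, Finset.mem_univ _, ?_⟩
      rw [← Finset.add_sum_erase _ _ (Finset.mem_univ i)] at hr1
      have h2 : ∑ j ∈ Finset.univ.erase i, r j = 0 := by omega
      rw [Finset.sum_eq_zero_iff] at h2
      funext j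
      by_cases hj : j = i
      · subst hj; simp; omega
      · simp [hj, h2 j (by simp [hj])]
    · intro i _
      congr 1
      funext j
      by_cases hj : j = i
      · subst hj; simp [h1]
      · simp [hj, h0]

theorem curve_dirDeriv {m : ℕ} (f : HomPoly K E F m) (x v : E) :
    Curve (fun t : K => f.1 (x + t • v)) (f.1 x) (dirDeriv f x v) := by
  have := Curve.multilinear f.2.choose (fun _ : Fin m => Curve.line (K := K) x v)
  refine this.congr (funext fun t => (f.2.choose_spec _).symm) (f.2.choose_spec _).symm rfl

/-- The derivative does not depend on the choice of the multilinear map. -/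
theorem dirDeriv_eq [Infinite K] {m : ℕ} (f : HomPoly K E F m)
    (u : MultilinearMap K (fun _ : Fin m => E) F) (hu : ∀ x, f.1 x = u fun _ => x) (x v : E) :
    dirDeriv f x v = ∑ i, u (Function.update (fun _ => x) i v) := by
  refine (curve_dirDeriv f x v).unique (a' := f.1 x) ?_
  have := Curve.multilinear u (fun _ : Fin m => Curve.line (K := K) x v)
  exact this.congr (funext fun t => (hu _).symm) (hu _).symm rfl

theorem dirDeriv_add_right {m : ℕ} (f : HomPoly K E F m) (x v w : E) :
    dirDeriv f x (v + w) = dirDeriv f x v + dirDeriv f x w := by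
  simp [dirDeriv, Finset.sum_add_distrib]

theorem dirDeriv_smul_right {m : ℕ} (f : HomPoly K E F m) (x v : E) (a : K) :
    dirDeriv f x (a • v) = a • dirDeriv f x v := by
  simp [dirDeriv, Finset.smul_sum]

/-- The derivative as a linear map of the direction. -/
noncomputable def dirDerivLin {m : ℕ} (f : HomPoly K E F m) (x : E) : E →ₗ[K] F where
  toFun := dirDeriv f x
  map_add' := dirDeriv_add_right f x
  map_smul' a v := dirDeriv_smul_right f x v a

theorem dirDeriv_zero_deg (f : HomPoly K E F 0) (x v : E) : dirDeriv f x v = 0 := by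
  simp [dirDeriv]

end Curves

section Sums

variable {M : Type*} [AddCommMonoid M]

theorem sum_assoc (s : ℕ) (f : ℕ → ℕ → ℕ → M) :
    ∑ p ∈ antidiagonal s, ∑ q ∈ antidiagonal p.2, f p.1 q.1 q.2 =
      ∑ p ∈ antidiagonal s, ∑ q ∈ antidiagonal p.1, f q.1 q.2 p.2 := by
  rw [Finset.sum_sigma', Finset.sum_sigma']
  refine Finset.sum_nbij' (fun x => ⟨(x.1.1 + x.2.1, x.2.2), (x.1.1, x.2.1)⟩)
    (fun x => ⟨(x.2.1, x.2.2 + x.1.2), (x.2.2, x.1.2)⟩) ?_ ?_ ?_ ?_ ?_ <;>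
  · rintro ⟨⟨a, b⟩, ⟨c, d⟩⟩ h
    simp only [Finset.mem_sigma, mem_antidiagonal] at h
    obtain ⟨rfl, h2⟩ := h
    subst h2
    simp [add_assoc]

theorem sum_swap (s : ℕ) (f : ℕ → ℕ → ℕ → M) :
    ∑ p ∈ antidiagonal s, ∑ q ∈ antidiagonal p.2, f p.1 q.1 q.2 =
      ∑ p ∈ antidiagonal s, ∑ q ∈ antidiagonal p.2, f q.1 p.1 q.2 := by
  rw [sum_assoc, sum_assoc s fun a b c => f b a c]
  refine Finset.sum_congr rfl fun p _ => ?_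
  rw [← Finset.Nat.sum_antidiagonal_swap]
  rfl

theorem sum_shift (s : ℕ) (f : ℕ → ℕ → ℕ → M) (h : f (s + 1) 0 0 = 0) :
    ∑ p ∈ antidiagonal s, ∑ q ∈ antidiagonal (p.2 + 1), f p.1 q.1 q.2 =
      ∑ p ∈ antidiagonal (s + 1), ∑ q ∈ antidiagonal p.2, f p.1 q.1 q.2 := by
  rw [Finset.Nat.sum_antidiagonal_succ' (n := s)]
  simp [h]

theorem sum_shift' (s : ℕ) (f : ℕ → ℕ → ℕ → M) (h : f 0 0 (s + 1) = 0) :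
    ∑ p ∈ antidiagonal s, ∑ q ∈ antidiagonal (p.1 + 1), f q.1 q.2 p.2 =
      ∑ p ∈ antidiagonal (s + 1), ∑ q ∈ antidiagonal p.1, f q.1 q.2 p.2 := by
  rw [Finset.Nat.sum_antidiagonal_succ (n := s)]
  simp [h]

end Sums

section SecondDerivative

variable {K E F : Type*} [Field K] [AddCommGroup E] [Module K E] [AddCommGroup F]
  [Module K F]

theorem dirDeriv_eq_of_curve [Infinite K] {m : ℕ} {f : HomPoly K E F m} {x v : E} {a d : F}
    (h : Curve (fun t : K => f.1 (x + t • v)) a d) : dirDeriv f x v = d :=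
  (curve_dirDeriv f x v).unique h

theorem dirDeriv_add_left [Infinite K] {m : ℕ} (f g : HomPoly K E F m) (x v : E) :
    dirDeriv (f + g) x v = dirDeriv f x v + dirDeriv g x v :=
  dirDeriv_eq_of_curve ((curve_dirDeriv f x v).add (curve_dirDeriv g x v))

theorem dirDeriv_smul_left [Infinite K] {m : ℕ} (a : K) (f : HomPoly K E F m) (x v : E) :
    dirDeriv (a • f) x v = a • dirDeriv f x v :=
  dirDeriv_eq_of_curve ((curve_dirDeriv f x v).linear (LinearMap.lsmul K F a))

/-- The second derivative at `x` in the directions `v`, `w`. -/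
noncomputable def dirDeriv₂ {m : ℕ} (f : HomPoly K E F m) (x v w : E) : F :=
  ∑ i, ∑ j ∈ Finset.univ.erase i,
    f.2.choose (Function.update (Function.update (fun _ => x) i w) j v)

theorem dirDeriv₂_comm {m : ℕ} (f : HomPoly K E F m) (x v w : E) :
    dirDeriv₂ f x v w = dirDeriv₂ f x w v := by
  unfold dirDeriv₂
  rw [Finset.sum_comm' (t' := Finset.univ) (s' := fun j => Finset.univ.erase j)]
  · refine Finset.sum_congr rfl fun j _ => Finset.sum_congr rfl fun i hi => ?_
    rw [Function.update_comm]
    simp at hi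
    exact hi
  · intro i j
    simp [eq_comm]

theorem curve_comp {q m : ℕ} (η : HomPoly K E E q) (f : HomPoly K E F m) (x v : E) :
    Curve (fun t : K => dirDeriv f (x + t • v) (η.1 (x + t • v))) (dirDeriv f x (η.1 x))
      (dirDeriv₂ f x v (η.1 x) + dirDeriv f x (dirDeriv η x v)) := by
  have key : ∀ i : Fin m, Curve
      (fun t : K => f.2.choose (Function.update (fun _ => x + t • v) i (η.1 (x + t • v))))
      (f.2.choose (Function.update (fun _ => x) i (η.1 x)))
      ((∑ j ∈ Finset.univ.erase i,
        f.2.choose (Function.update (Function.update (fun _ => x) i (η.1 x)) j v)) +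
        f.2.choose (Function.update (fun _ => x) i (dirDeriv η x v))) := by
    intro i
    have := Curve.multilinear f.2.choose
      (γ := fun j t => Function.update (fun _ => x + t • v) i (η.1 (x + t • v)) j)
      (a := Function.update (fun _ => x) i (η.1 x))
      (d := Function.update (fun _ => v) i (dirDeriv η x v)) (by
        intro j
        by_cases hj : j = i
        · subst hj; simpa using curve_dirDeriv η x v
        · simpa [hj] using Curve.line (K := K) x v)
    refine this.congr rfl rfl ?_
    rw [← Finset.sum_erase_add _ _ (Finset.mem_univ i)]
    congr 1
    · refine Finset.sum_congr rfl fun j hj => ?_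
      have hj : j ≠ i := by simpa using hj
      simp [hj]
    · simp
  have := Curve.sum Finset.univ (fun i _ => key i)
  refine this.congr rfl rfl ?_
  rw [Finset.sum_add_distrib]
  rfl

theorem dirDeriv_seriesDeriv [Infinite K] (η : FormalSeries K E E) (f : FormalSeries K E F) (k : ℕ)
    (x v : E) : dirDeriv (seriesDeriv η f k) x v = ∑ p ∈ antidiagonal (k + 1),
      (dirDeriv₂ (f p.2) x v ((η p.1).1 x) + dirDeriv (f p.2) x (dirDeriv (η p.1) x v)) :=
  dirDeriv_eq_of_curve (Curve.sum _ fun p _ => curve_comp (η p.1) (f p.2) x v)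

theorem seriesDeriv_comp_coe [Infinite K] (ξ η : FormalSeries K E E) (f : FormalSeries K E F) (s : ℕ)
    (x : E) : (seriesDeriv ξ (seriesDeriv η f) s).1 x =
      ∑ p ∈ antidiagonal (s + 2), ∑ q ∈ antidiagonal p.2,
        dirDeriv₂ (f q.2) x ((ξ p.1).1 x) ((η q.1).1 x) +
      ∑ p ∈ antidiagonal (s + 2), ∑ q ∈ antidiagonal p.2,
        dirDeriv (f q.2) x (dirDeriv (η q.1) x ((ξ p.1).1 x)) := by
  have := sum_shift (s + 1) (fun a b c => dirDeriv₂ (f c) x ((ξ a).1 x) ((η b).1 x) +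
    dirDeriv (f c) x (dirDeriv (η b) x ((ξ a).1 x))) (by simp [dirDeriv, dirDeriv₂])
  simp only [← Finset.sum_add_distrib]
  rw [← this, seriesDeriv_coe]
  exact Finset.sum_congr rfl fun p _ => dirDeriv_seriesDeriv η f p.2 x ((ξ p.1).1 x)

theorem seriesDeriv_add_right [Infinite K] (ξ : FormalSeries K E E) (f g : FormalSeries K E F) :
    seriesDeriv ξ (f + g) = seriesDeriv ξ f + seriesDeriv ξ g :=
  FormalSeries.ext fun s x => by
    simp only [FormalSeries.add_coe, seriesDeriv_coe]
    rw [← Finset.sum_add_distrib]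
    exact Finset.sum_congr rfl fun p _ => dirDeriv_add_left _ _ _ _

theorem seriesDeriv_smul_right [Infinite K] (a : K) (ξ : FormalSeries K E E) (f : FormalSeries K E F) :
    seriesDeriv ξ (a • f) = a • seriesDeriv ξ f :=
  FormalSeries.ext fun s x => by
    simp only [FormalSeries.smul_coe, seriesDeriv_coe]
    rw [Finset.smul_sum]
    exact Finset.sum_congr rfl fun p _ => dirDeriv_smul_left _ _ _ _

theorem seriesDeriv_add_left (ξ η : FormalSeries K E E) (f : FormalSeries K E F) :
    seriesDeriv (ξ + η) f = seriesDeriv ξ f + seriesDeriv η f :=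
  FormalSeries.ext fun s x => by
    simp only [FormalSeries.add_coe, seriesDeriv_coe]
    rw [← Finset.sum_add_distrib]
    exact Finset.sum_congr rfl fun p _ => dirDeriv_add_right _ _ _ _

theorem seriesDeriv_smul_left (a : K) (ξ : FormalSeries K E E) (f : FormalSeries K E F) :
    seriesDeriv (a • ξ) f = a • seriesDeriv ξ f :=
  FormalSeries.ext fun s x => by
    simp only [FormalSeries.smul_coe, seriesDeriv_coe]
    rw [Finset.smul_sum]
    exact Finset.sum_congr rfl fun p _ => dirDeriv_smul_right _ _ _ _

theorem seriesDeriv_bracket [Infinite K] (ξ η : FormalSeries K E E) (f : FormalSeries K E F) :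
    seriesDeriv ξ (seriesDeriv η f) - seriesDeriv η (seriesDeriv ξ f) =
      seriesDeriv (seriesDeriv ξ η - seriesDeriv η ξ) f := by
  refine FormalSeries.ext fun s x => ?_
  rw [FormalSeries.sub_coe, seriesDeriv_comp_coe, seriesDeriv_comp_coe,
    sum_swap (s + 2) (fun a b c => dirDeriv₂ (f c) x ((η a).1 x) ((ξ b).1 x))]
  simp only [dirDeriv₂_comm (f _) x ((η _).1 x)]
  rw [add_sub_add_left_eq_sub,
    sum_assoc (s + 2) (fun a b c => dirDeriv (f c) x (dirDeriv (η b) x ((ξ a).1 x))),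
    sum_assoc (s + 2) (fun a b c => dirDeriv (f c) x (dirDeriv (ξ b) x ((η a).1 x))),
    ← sum_shift' (s + 1) (fun a b c => dirDeriv (f c) x (dirDeriv (η b) x ((ξ a).1 x))) (by
      rw [dirDeriv_zero_deg]; exact map_zero (dirDerivLin _ _)),
    ← sum_shift' (s + 1) (fun a b c => dirDeriv (f c) x (dirDeriv (ξ b) x ((η a).1 x))) (by
      rw [dirDeriv_zero_deg]; exact map_zero (dirDerivLin _ _)),
    ← Finset.sum_sub_distrib]
  refine Finset.sum_congr rfl fun p _ => ?_
  change _ = dirDerivLin (f p.2) x (_ - _)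
  rw [map_sub]
  rw [seriesDeriv_coe, seriesDeriv_coe, map_sum, map_sum]
  rfl

end SecondDerivative

section LieSeries

variable {K E A : Type*} [Field K] [AddCommGroup E] [Module K E] [LieRing A] [LieAlgebra K A]

/-- The bracket of `A` as a multilinear map. -/
def lieMultilinear (K A : Type*) [Field K] [LieRing A] [LieAlgebra K A] :
    MultilinearMap K (fun _ : Fin 2 => A) A where
  toFun x := ⁅x 0, x 1⁆
  map_update_add' := by
    intro _ x i a b
    fin_cases i <;> simp
  map_update_smul' := by
    intro _ x i a b
    fin_cases i <;> simp

theorem Curve.lie {γ δ : K → A} {a a' d d' : A} (h : Curve γ a d) (h' : Curve δ a' d') :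
    Curve (fun t => ⁅γ t, δ t⁆) ⁅a, a'⁆ (⁅d, a'⁆ + ⁅a, d'⁆) := by
  have := Curve.multilinear (lieMultilinear K A) (γ := ![γ, δ]) (a := ![a, a']) (d := ![d, d'])
    (by intro i; fin_cases i <;> simpa)
  refine this.congr rfl rfl ?_
  simp [lieMultilinear, Fin.sum_univ_two]

theorem lie_mem {n r : ℕ} {f g : E → A} (hf : f ∈ HomPoly K E A n) (hg : g ∈ HomPoly K E A r) :
    (fun x => ⁅f x, g x⁆) ∈ HomPoly K E A (n + r) := by
  have := comp_mem (lieMultilinear K A) ![n, r] ![f, g]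
    (by intro i; fin_cases i <;> simpa)
  simpa [Fin.sum_univ_two, lieMultilinear] using this

/-- The bracket of `A[[E]]` is pointwise: `[f, g]_s (x) = ∑_{n + r = s} [f_n (x), g_r (x)]`. -/
instance : Bracket (FormalSeries K E A) (FormalSeries K E A) where
  bracket f g := fun s =>
    ⟨fun x => ∑ p ∈ antidiagonal s, ⁅(f p.1).1 x, (g p.2).1 x⁆, by
      have := Submodule.sum_mem (HomPoly K E A s)
        (f := fun p : ℕ × ℕ => fun x => ⁅(f p.1).1 x, (g p.2).1 x⁆)
        (fun p (hp : p ∈ antidiagonal s) =>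
          mem_antidiagonal.mp hp ▸ lie_mem (f p.1).2 (g p.2).2)
      refine (congrArg (· ∈ HomPoly K E A s) ?_).mp this
      funext x
      simp⟩

theorem lie_coe (f g : FormalSeries K E A) (s : ℕ) (x : E) :
    (⁅f, g⁆ s).1 x = ∑ p ∈ antidiagonal s, ⁅(f p.1).1 x, (g p.2).1 x⁆ := rfl

instance [CharZero K] : LieRing (FormalSeries K E A) where
  add_lie f g h := FormalSeries.ext fun s x => by
    simp [lie_coe, Finset.sum_add_distrib]
  lie_add f g h := FormalSeries.ext fun s x => by
    simp [lie_coe, Finset.sum_add_distrib]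
  lie_self f := FormalSeries.ext fun s x => by
    have h : (⁅f, f⁆ s).1 x = - (⁅f, f⁆ s).1 x := by
      rw [lie_coe, ← Finset.sum_neg_distrib, ← Finset.Nat.sum_antidiagonal_swap]
      simp
    have h2 : (2 : K) • (⁅f, f⁆ s).1 x = 0 := by
      rw [two_smul]
      nth_rewrite 1 [h]
      exact neg_add_cancel _
    exact (smul_eq_zero.mp h2).resolve_left two_ne_zero
  leibniz_lie f g h := FormalSeries.ext fun s x => by
    simp only [FormalSeries.add_coe, lie_coe, lie_sum, sum_lie]
    rw [← sum_assoc s (fun a b c => ⁅⁅(f a).1 x, (g b).1 x⁆, (h c).1 x⁆),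
      sum_swap s (fun a b c => ⁅(g a).1 x, ⁅(f b).1 x, (h c).1 x⁆⁆)]
    simp only [← Finset.sum_add_distrib]
    exact Finset.sum_congr rfl fun p _ => Finset.sum_congr rfl fun q _ => leibniz_lie _ _ _

instance [CharZero K] : LieAlgebra K (FormalSeries K E A) where
  lie_smul a f g := FormalSeries.ext fun s x => by
    simp [lie_coe, Finset.smul_sum]

theorem dirDeriv_lie [CharZero K] (f g : FormalSeries K E A) (s : ℕ) (x v : E) :
    dirDeriv (⁅f, g⁆ s) x v = ∑ p ∈ antidiagonal s,
      (⁅dirDeriv (f p.1) x v, (g p.2).1 x⁆ + ⁅(f p.1).1 x, dirDeriv (g p.2) x v⁆) :=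
  dirDeriv_eq_of_curve (Curve.sum _ fun p _ =>
    (curve_dirDeriv (f p.1) x v).lie (curve_dirDeriv (g p.2) x v))

theorem seriesDeriv_lie [CharZero K] (ξ : FormalSeries K E E) (f g : FormalSeries K E A) :
    seriesDeriv ξ ⁅f, g⁆ = ⁅f, seriesDeriv ξ g⁆ + ⁅seriesDeriv ξ f, g⁆ := by
  refine FormalSeries.ext fun s x => ?_
  simp only [FormalSeries.add_coe, lie_coe, seriesDeriv_coe, dirDeriv_lie, lie_sum, sum_lie,
    Finset.sum_add_distrib]
  rw [sum_shift s (fun a b c => ⁅(f a).1 x, dirDeriv (g c) x ((ξ b).1 x)⁆)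
      (by simp [dirDeriv_zero_deg]),
    sum_swap (s + 1) (fun a b c => ⁅(f a).1 x, dirDeriv (g c) x ((ξ b).1 x)⁆),
    sum_assoc (s + 1) (fun a b c => ⁅dirDeriv (f b) x ((ξ a).1 x), (g c).1 x⁆),
    sum_shift' s (fun a b c => ⁅dirDeriv (f b) x ((ξ a).1 x), (g c).1 x⁆)
      (by simp [dirDeriv_zero_deg]), add_comm]

/-- The derivation `f ↦ ξ . f` of the Lie algebra `A[[E]]`. -/
noncomputable def seriesDerivation [CharZero K] (ξ : FormalSeries K E E) :
    LieDerivation K (FormalSeries K E A) (FormalSeries K E A) where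
  toFun := seriesDeriv ξ
  map_add' := seriesDeriv_add_right ξ
  map_smul' a f := seriesDeriv_smul_right a ξ f
  leibniz' f g := by
    change seriesDeriv ξ ⁅f, g⁆ = ⁅f, seriesDeriv ξ g⁆ - ⁅g, seriesDeriv ξ f⁆
    rw [seriesDeriv_lie, ← lie_skew g, sub_neg_eq_add]

end LieSeries

section Coefficients

variable (K : Type*) [Field K] [CharZero K]

/-- The coefficient `t_n` of `T ^ n` in `G(T) = T e^T / (e^T - 1)`; Mathlib's
`bernoulli'PowerSeries` is this power series, as recalled in `tCoeff_spec`. -/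
noncomputable def tCoeff (n : ℕ) : K := PowerSeries.coeff n (bernoulli'PowerSeries K)

theorem tCoeff_spec :
    PowerSeries.mk (tCoeff K) * (PowerSeries.exp K - 1) = PowerSeries.X * PowerSeries.exp K := by
  have : PowerSeries.mk (tCoeff K) = bernoulli'PowerSeries K := by ext n; simp [tCoeff]
  rw [this, bernoulli'PowerSeries_mul_exp_sub_one]

open MvPolynomial in
theorem tCoeff_polynomial (m : ℕ) :
    C (tCoeff K m) * (X 0 + X 1) ^ m = ∑ p ∈ antidiagonal (m + 1),
      C (tCoeff K p.1 * tCoeff K p.2) * (X 0 ^ p.1 * (∑ k ∈ Finset.range p.2,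
        (X 0 + X 1) ^ k * X 1 ^ (p.2 - 1 - k)) + X 1 ^ p.2 * (∑ k ∈ Finset.range p.1,
        (X 0 + X 1) ^ k * X 0 ^ (p.1 - 1 - k)) : MvPolynomial (Fin 2) K) := by
  set x : MvPolynomial (Fin 2) K := X 0 with hx
  set y : MvPolynomial (Fin 2) K := X 1 with hy
  have hx0 : x ≠ 0 := X_ne_zero _
  have hy0 : y ≠ 0 := X_ne_zero _
  have hxy0 : x + y ≠ 0 := by
    intro h
    have := congrArg (eval (fun _ => (1 : K))) h
    simp [hx, hy] at this
  let G (a : MvPolynomial (Fin 2) K) := PowerSeries.rescale a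
    (PowerSeries.map (C : K →+* MvPolynomial (Fin 2) K) (bernoulli'PowerSeries K))
  let e (a : MvPolynomial (Fin 2) K) := PowerSeries.rescale a
    (PowerSeries.exp (MvPolynomial (Fin 2) K))
  have hG : ∀ a, G a * (e a - 1) = PowerSeries.C a * PowerSeries.X * e a := by
    intro a
    have h1 := congrArg (PowerSeries.map (C : K →+* MvPolynomial (Fin 2) K))
      (bernoulli'PowerSeries_mul_exp_sub_one K)
    simp only [map_mul, map_sub, map_one, PowerSeries.map_exp, PowerSeries.map_X] at h1
    have h2 := congrArg (PowerSeries.rescale a) h1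
    simp only [map_mul, map_sub, map_one, PowerSeries.rescale_X] at h2
    exact h2
  have he : e x * e y = e (x + y) := PowerSeries.exp_mul_exp_eq_exp_add x y
  have hne : ∀ a : MvPolynomial (Fin 2) K, a ≠ 0 → e a - 1 ≠ 0 := by
    intro a ha h
    have := congrArg (PowerSeries.coeff 1) h
    simp [e, PowerSeries.coeff_rescale, PowerSeries.coeff_exp, PowerSeries.coeff_one] at this
    exact ha this
  have key : PowerSeries.C (x * y) * (PowerSeries.X * G (x + y)) =
      PowerSeries.C y * (G x * G (x + y)) + PowerSeries.C x * (G (x + y) * G y) -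
        PowerSeries.C (x + y) * (G x * G y) := by
    apply mul_right_cancel₀ (hne x hx0)
    apply mul_right_cancel₀ (hne y hy0)
    apply mul_right_cancel₀ (hne (x + y) hxy0)
    have h1 := hG x
    have h2 := hG y
    have h3 := hG (x + y)
    rw [← he] at h3 ⊢
    simp only [map_mul, map_add] at h1 h2 h3 ⊢
    linear_combination
      (PowerSeries.C x * PowerSeries.C y * PowerSeries.X * (e x - 1) * (e y - 1) -
        PowerSeries.C y * (e y - 1) * (G x * (e x - 1)) -
        PowerSeries.C x * (e x - 1) * (G y * (e y - 1))) * h3 +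
      (-PowerSeries.C y * (e y - 1) *
          ((PowerSeries.C x + PowerSeries.C y) * PowerSeries.X * (e x * e y)) +
        (PowerSeries.C x + PowerSeries.C y) * (e x * e y - 1) * (G y * (e y - 1))) * h1 +
      (-PowerSeries.C x * (e x - 1) *
          ((PowerSeries.C x + PowerSeries.C y) * PowerSeries.X * (e x * e y)) +
        (PowerSeries.C x + PowerSeries.C y) * (e x * e y - 1) *
          (PowerSeries.C x * PowerSeries.X * e x)) * h2
  have hcoef := congrArg (PowerSeries.coeff (m + 1)) key
  have hGc : ∀ a n, PowerSeries.coeff n (G a) = a ^ n * C (tCoeff K n) := by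
    intro a n
    simp [G, tCoeff, PowerSeries.coeff_rescale]
  rw [map_sub, map_add (PowerSeries.coeff (m + 1))] at hcoef
  simp only [PowerSeries.coeff_C_mul, PowerSeries.coeff_succ_X_mul] at hcoef
  simp only [PowerSeries.coeff_mul, hGc] at hcoef
  apply mul_left_cancel₀ (mul_ne_zero hx0 hy0)
  calc _ = x * y * ((x + y) ^ m * C (tCoeff K m)) := by ring
    _ = _ := by
      rw [hcoef]
      simp only [Finset.mul_sum (antidiagonal (m + 1))]
      rw [← Finset.sum_add_distrib, ← Finset.sum_sub_distrib]
      refine Finset.sum_congr rfl fun p _ => ?_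
      have g1 := geom_sum₂_mul (x + y) y p.2
      have g2 := geom_sum₂_mul (x + y) x p.1
      rw [add_sub_cancel_right] at g1
      rw [add_sub_cancel_left] at g2
      rw [map_mul]
      linear_combination (-(C (tCoeff K p.1) * C (tCoeff K p.2) * y * x ^ p.1)) * g1 -
        (C (tCoeff K p.1) * C (tCoeff K p.2) * x * y ^ p.2) * g2

end Coefficients

section FundamentalAction

variable {K B : Type*} [Field K] [LieRing B] [LieAlgebra K B]

theorem ad_pow_mem (b : B) (n : ℕ) :
    (fun y => ((LieAlgebra.ad K B y) ^ n) b) ∈ HomPoly K B B n := by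
  induction n with
  | zero => simpa using const_mem (K := K) (E := B) b
  | succ n ih =>
    have := lie_mem (linear_mem (LinearMap.id (R := K) (M := B))) ih
    rw [add_comm] at this
    simpa [pow_succ'] using this

theorem curve_ad_pow (b y v : B) (n : ℕ) :
    Curve (fun t : K => ((LieAlgebra.ad K B (y + t • v)) ^ n) b)
      (((LieAlgebra.ad K B y) ^ n) b)
      (∑ k ∈ Finset.range n, ((LieAlgebra.ad K B y) ^ k)
        ⁅v, ((LieAlgebra.ad K B y) ^ (n - 1 - k)) b⁆) := by
  induction n with
  | zero => exact (Curve.line b (0 : B)).congr (by simp) (by simp) (by simp)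
  | succ n ih =>
    have := (Curve.line (K := K) y v).lie ih
    refine this.congr ?_ ?_ ?_
    · funext t; simp [pow_succ']
    · simp [pow_succ']
    · rw [Finset.sum_range_succ', add_comm, lie_sum]
      congr 1
      refine Finset.sum_congr rfl fun k hk => ?_
      rw [show n + 1 - 1 - (k + 1) = n - 1 - k by omega, pow_succ']
      simp

variable [CharZero K]

/-- The series `d_b ∈ B[[B]]` with `d_b (y) = ∑_n t_n (ad y) ^ n (b)`. -/
noncomputable def fundamentalSeries (b : B) : FormalSeries K B B := fun n =>
  ⟨fun y => tCoeff K n • ((LieAlgebra.ad K B y) ^ n) b,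
    Submodule.smul_mem _ _ (ad_pow_mem b n)⟩

theorem fundamentalSeries_coe (b : B) (n : ℕ) (y : B) :
    ((fundamentalSeries b : FormalSeries K B B) n).1 y =
      tCoeff K n • ((LieAlgebra.ad K B y) ^ n) b := rfl

theorem dirDeriv_fundamentalSeries (b : B) (n : ℕ) (y v : B) :
    dirDeriv ((fundamentalSeries b : FormalSeries K B B) n) y v =
      tCoeff K n • ∑ k ∈ Finset.range n, ((LieAlgebra.ad K B y) ^ k)
        ⁅v, ((LieAlgebra.ad K B y) ^ (n - 1 - k)) b⁆ :=
  dirDeriv_eq_of_curve ((curve_ad_pow b y v n).linear (LinearMap.lsmul K B (tCoeff K n)))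

theorem tCoeff_lie (a b y : B) (m : ℕ) :
    tCoeff K m • ((LieAlgebra.ad K B y) ^ m) ⁅a, b⁆ = ∑ p ∈ antidiagonal (m + 1),
      (tCoeff K p.1 * tCoeff K p.2) •
        ((∑ k ∈ Finset.range p.2, ((LieAlgebra.ad K B y) ^ k)
          ⁅((LieAlgebra.ad K B y) ^ p.1) a, ((LieAlgebra.ad K B y) ^ (p.2 - 1 - k)) b⁆) +
        ∑ k ∈ Finset.range p.1, ((LieAlgebra.ad K B y) ^ k)
          ⁅((LieAlgebra.ad K B y) ^ (p.1 - 1 - k)) a, ((LieAlgebra.ad K B y) ^ p.2) b⁆) := by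
  set D := LieAlgebra.ad K B y with hD
  let Φ : MvPolynomial (Fin 2) K →ₗ[K] B :=
    (MvPolynomial.basisMonomials (Fin 2) K).constr K fun σ => ⁅(D ^ σ 0) a, (D ^ σ 1) b⁆
  have hmon : ∀ i j : ℕ, Φ (MvPolynomial.X 0 ^ i * MvPolynomial.X 1 ^ j) =
      ⁅(D ^ i) a, (D ^ j) b⁆ := by
    intro i j
    have h1 : (MvPolynomial.X 0 ^ i * MvPolynomial.X 1 ^ j : MvPolynomial (Fin 2) K) =
        MvPolynomial.basisMonomials (Fin 2) K (Finsupp.single 0 i + Finsupp.single 1 j) := by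
      simp [MvPolynomial.X_pow_eq_monomial, MvPolynomial.monomial_mul]
    rw [h1, Module.Basis.constr_basis]
    simp
  have hmul : ∀ P, Φ ((MvPolynomial.X 0 + MvPolynomial.X 1) * P) = D (Φ P) := by
    intro P
    induction P using MvPolynomial.induction_on' with
    | add P Q hP hQ => rw [mul_add, map_add, map_add, map_add, hP, hQ]
    | monomial σ c =>
      have h1 : (MvPolynomial.monomial σ c : MvPolynomial (Fin 2) K) =
          c • (MvPolynomial.X 0 ^ σ 0 * MvPolynomial.X 1 ^ σ 1) := by
        rw [MvPolynomial.monomial_eq, MvPolynomial.smul_eq_C_mul,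
          Finsupp.prod_fintype _ _ (by simp), Fin.prod_univ_two]
      rw [h1, mul_smul_comm, map_smul, map_smul, map_smul, add_mul, map_add]
      rw [← mul_assoc, ← pow_succ', hmon, mul_left_comm, ← pow_succ', hmon, hmon]
      simp [hD, pow_succ']
  have hpow : ∀ k P, Φ ((MvPolynomial.X 0 + MvPolynomial.X 1) ^ k * P) = (D ^ k) (Φ P) := by
    intro k P
    induction k with
    | zero => simp
    | succ k ih => rw [pow_succ', mul_assoc, hmul, ih, pow_succ']; rfl
  have h0 := congrArg Φ (tCoeff_polynomial K m)
  have h2 := hpow m 1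
  have h3 := hmon 0 0
  simp only [pow_zero, mul_one, Module.End.one_apply] at h2 h3
  rw [← MvPolynomial.smul_eq_C_mul, map_smul, h2, h3, map_sum] at h0
  rw [h0]
  refine Finset.sum_congr rfl fun p _ => ?_
  rw [← MvPolynomial.smul_eq_C_mul, map_smul, map_add, Finset.mul_sum, Finset.mul_sum, map_sum,
    map_sum]
  congr 2
  · refine Finset.sum_congr rfl fun k _ => ?_
    rw [mul_left_comm, hpow, hmon]
  · refine Finset.sum_congr rfl fun k _ => ?_
    rw [mul_left_comm, hpow, mul_comm, hmon]

/-- The fundamental action `b ↦ d_b` respects the brackets. -/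
theorem fundamentalSeries_lie (a b : B) :
    (fundamentalSeries ⁅a, b⁆ : FormalSeries K B B) =
      seriesDeriv (fundamentalSeries a) (fundamentalSeries b) -
        seriesDeriv (fundamentalSeries b) (fundamentalSeries a) := by
  refine FormalSeries.ext fun m y => ?_
  rw [fundamentalSeries_coe, tCoeff_lie, FormalSeries.sub_coe, seriesDeriv_coe, seriesDeriv_coe,
    ← Finset.Nat.sum_antidiagonal_swap (n := m + 1)
      (f := fun p => dirDeriv ((fundamentalSeries a : FormalSeries K B B) p.2) y
        (((fundamentalSeries b : FormalSeries K B B) p.1).1 y)),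
    ← Finset.sum_sub_distrib]
  refine Finset.sum_congr rfl fun p _ => ?_
  simp only [dirDeriv_fundamentalSeries, fundamentalSeries_coe, Prod.fst_swap, Prod.snd_swap,
    smul_lie, map_smul, ← Finset.smul_sum, smul_smul]
  rw [mul_comm (tCoeff K p.2), ← smul_sub, sub_eq_add_neg, ← Finset.sum_neg_distrib]
  congr 2
  refine Finset.sum_congr rfl fun k _ => ?_
  rw [← map_neg, lie_skew]

end FundamentalAction

section Wreath

variable (K A B : Type*) [Field K] [CharZero K] [LieRing A] [LieAlgebra K A] [LieRing B]
  [LieAlgebra K B]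

/-- The homomorphism from `B` to the derivations of `A[[B]]`, `b ↦ (f ↦ d_b . f)`. -/
noncomputable def fundamentalDerivation :
    B →ₗ⁅K⁆ LieDerivation K (FormalSeries K B A) (FormalSeries K B A) where
  toFun b := seriesDerivation (fundamentalSeries b)
  map_add' a b := by
    refine LieDerivation.ext fun f => ?_
    change seriesDeriv _ f = seriesDeriv _ f + seriesDeriv _ f
    rw [← seriesDeriv_add_left]
    congr 1
    exact FormalSeries.ext fun m y => by simp [fundamentalSeries_coe]
  map_smul' c b := by
    refine LieDerivation.ext fun f => ?_
    change seriesDeriv _ f = c • seriesDeriv _ f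
    rw [← seriesDeriv_smul_left]
    congr 1
    exact FormalSeries.ext fun m y => by simp [fundamentalSeries_coe, smul_comm c]
  map_lie' := by
    intro a b
    refine LieDerivation.ext fun f => ?_
    rw [LieDerivation.commutator_apply]
    change seriesDeriv _ f = seriesDeriv _ (seriesDeriv _ f) - seriesDeriv _ (seriesDeriv _ f)
    rw [seriesDeriv_bracket, fundamentalSeries_lie]

/-- The wreath product `W(A, B) = A[[B]] ⋊ B`. -/
abbrev Wreath : Type _ :=
  LieAlgebra.SemiDirectSum (FormalSeries K B A) B (fundamentalDerivation K A B)

/-- The bracket of the wreath product: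
`[(f, b), (g, c)] = ([f, g] + d_b . g - d_c . f, [b, c])`. -/
theorem Wreath.lie_mk (f g : FormalSeries K B A) (b c : B) :
    ⁅(⟨f, b⟩ : Wreath K A B), (⟨g, c⟩ : Wreath K A B)⁆ =
      ⟨⁅f, g⁆ + seriesDeriv (fundamentalSeries b) g - seriesDeriv (fundamentalSeries c) f,
        ⁅b, c⁆⟩ := rfl

end Wreath

section Representation

variable {K B C : Type*} [Field K] [CharZero K] [LieRing B] [LieAlgebra K B] [LieRing C]
  [LieAlgebra K C]

/-- The element `h_{c,m} (y) = (1 / m!) R ^ m c - ∑_{n + r = m} (t_r / (n + 1)!) R ^ n s p R ^ r c`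
of `C`, where `R = ad (s y)`. -/
noncomputable def reprComponent (p : C →ₗ⁅K⁆ B) (s : B →ₗ[K] C) (c : C) (m : ℕ) (y : B) : C :=
  (1 / (m.factorial : K)) • ((LieAlgebra.ad K C (s y)) ^ m) c -
    ∑ q ∈ antidiagonal m, (tCoeff K q.2 / ((q.1 + 1).factorial : K)) •
      ((LieAlgebra.ad K C (s y)) ^ q.1) (s (p (((LieAlgebra.ad K C (s y)) ^ q.2) c)))

end Representation

end Entrelacement

namespace Entrelacement

open Finset.HasAntidiagonal (antidiagonal mem_antidiagonal)

/-! ### Reindexing of convolution sums. -/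

section Sums

variable {M : Type*} [AddCommMonoid M]

/-! Write `R = ad (s y)`, `E c = e ^ R c` and `ω ξ = ((e ^ R - 1) / R) (s ξ)`, as series in
`C[[B]]`. Since `p (s y) = y`, one has `t_r p R ^ r c = t_r (ad y) ^ r (p c)`, the degree `r`
component of `d_{p c}`; hence `h_c = E c - ω (d_{p c})` (`reprSeries_coe`).

The homomorphism property is a gauge transformation. Put `[ξ, η] = ξ . η - η . ξ` on `B[[B]]`. Three
facts about the exponential are needed: `E [c, d] = [E c, E d]` (`expSeries_lie`); `ξ . E c = [ω ξ,
E c]` (`seriesDeriv_expSeries`); and the Maurer–Cartan equation `ξ . ω η - η . ω ξ = [ω ξ, ω η] + ω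
[ξ, η]` (`seriesDeriv_maurerCartan_sub`). The last two say that the connection `ξ - ω ξ` is flat and
annihilates every `E c`. As `b ↦ d_b` respects brackets, so does `c ↦ E c + (d_{p c} - ω (d_{p c}))
= h_c + d_{p c}` (`reprSeries_lie`).

The three facts are proved one degree at a time. The terms `R ^ n c / (n + a)!` satisfy a
first-order recursion in `n`, and so do their Cauchy products (`smul_sum_lie_adExp`); in
characteristic `0` this recursion determines each term from the preceding one.

The values lie in `A` because `p` sends `h_c` to `e ^ (ad y) (p c) - ((e ^ (ad y) - 1) / ad y) d_{p
c} (y)`, which vanishes by the definition of the `t_n` (`map_reprComponent`). Injectivity holds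
because `h_{c,0} = c` when `p c = 0`. -/

theorem sum_swap_outer (s : ℕ) (f : ℕ → ℕ → ℕ → M) :
    ∑ p ∈ antidiagonal s, ∑ q ∈ antidiagonal p.2, f p.1 q.1 q.2 =
      ∑ p ∈ antidiagonal s, ∑ q ∈ antidiagonal p.2, f q.2 q.1 p.1 := by
  rw [sum_assoc, ← Finset.Nat.sum_antidiagonal_swap]
  refine Finset.sum_congr rfl fun p _ => ?_
  rw [← Finset.Nat.sum_antidiagonal_swap]
  rfl

/-- Matches the nested sum left by the Maurer–Cartan equation with the bracket of two series that
are themselves convolutions. -/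
theorem sum_assoc_four (s : ℕ) (f : ℕ → ℕ → ℕ → ℕ → M) :
    ∑ p ∈ antidiagonal s, ∑ q ∈ antidiagonal p.2, ∑ k ∈ antidiagonal q.1, f k.1 p.1 k.2 q.2 =
      ∑ p ∈ antidiagonal s, ∑ q ∈ antidiagonal p.1, ∑ r ∈ antidiagonal p.2,
        f q.1 q.2 r.1 r.2 := by
  rw [← sum_assoc s fun a b c => ∑ r ∈ antidiagonal c, f a b r.1 r.2,
    sum_swap s fun a b c => ∑ r ∈ antidiagonal c, f a b r.1 r.2]
  exact Finset.sum_congr rfl fun p _ => (sum_assoc p.2 fun a b c => f a p.1 b c).symm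

/-- Absorbs the drop of degree under differentiation when the middle factor, a derivative of `R ^
n`, vanishes for `n = 0`. -/
theorem sum_middle_succ (s : ℕ) (f : ℕ → ℕ → ℕ → M) (h : ∀ a c, f a 0 c = 0) :
    ∑ p ∈ antidiagonal (s + 1), ∑ q ∈ antidiagonal p.2, f p.1 q.1 q.2 =
      ∑ p ∈ antidiagonal s, ∑ q ∈ antidiagonal p.2, f p.1 (q.1 + 1) q.2 := by
  rw [sum_swap, Finset.Nat.sum_antidiagonal_succ, sum_swap s fun a b c => f a (b + 1) c]
  simp [h]

end Sums

/-! ### Exponential series of `ad x`, one degree at a time. -/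

section AdExp

variable (K : Type*) {C : Type*} [Field K] [LieRing C] [LieAlgebra K C]

/-- The coefficients `(ad x) ^ n c / (n + a)!`; for `a = 0` they sum up to `e ^ (ad x) c`, for
`a = 1` to `((e ^ (ad x) - 1) / ad x) c`. -/
noncomputable def adExp (a : ℕ) (x c : C) (n : ℕ) : C :=
  ((n + a).factorial : K)⁻¹ • ((LieAlgebra.ad K C x) ^ n) c

/-- The derivative of `x ↦ (ad x) ^ n c` in the direction `v`. -/
def adPowDeriv (x v c : C) : ℕ → C
  | 0 => 0
  | n + 1 => ⁅v, ((LieAlgebra.ad K C x) ^ n) c⁆ + ⁅x, adPowDeriv x v c n⁆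

variable {K}

/-- Leibniz rule with both the point `x` and the vector `c` moving: in `ω ξ` the vector `s (ξ y)`
depends on `y` too. -/
theorem Curve.ad_pow {X Γ : K → C} {x v c e : C} (hX : Curve X x v) (hΓ : Curve Γ c e) (n : ℕ) :
    Curve (fun t => ((LieAlgebra.ad K C (X t)) ^ n) (Γ t)) (((LieAlgebra.ad K C x) ^ n) c)
      (adPowDeriv K x v c n + ((LieAlgebra.ad K C x) ^ n) e) := by
  induction n with
  | zero => exact hΓ.congr (by simp) (by simp) (by simp [adPowDeriv])
  | succ n ih =>
    refine (hX.lie ih).congr ?_ ?_ ?_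
    · funext t; simp [pow_succ']
    · simp [pow_succ']
    · simp [pow_succ', adPowDeriv, add_assoc]

theorem Curve.adExp (a : ℕ) {X Γ : K → C} {x v c e : C} (hX : Curve X x v) (hΓ : Curve Γ c e)
    (n : ℕ) : Curve (fun t => adExp K a (X t) (Γ t) n) (adExp K a x c n)
      (((n + a).factorial : K)⁻¹ • adPowDeriv K x v c n + Entrelacement.adExp K a x e n) :=
  ((hX.ad_pow hΓ n).linear (LinearMap.lsmul K C ((n + a).factorial : K)⁻¹)).congr rfl rfl
    (by simp [Entrelacement.adExp])

theorem adExp_add (a : ℕ) (x c d : C) (n : ℕ) :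
    adExp K a x (c + d) n = adExp K a x c n + adExp K a x d n := by
  simp [adExp]

theorem adExp_sum (a : ℕ) (x : C) {ι : Type*} (S : Finset ι) (c : ι → C) (n : ℕ) :
    adExp K a x (∑ j ∈ S, c j) n = ∑ j ∈ S, adExp K a x (c j) n := by
  simp [adExp, Finset.smul_sum]

theorem adExp_smul (a : ℕ) (x c : C) (k : K) (n : ℕ) :
    adExp K a x (k • c) n = k • adExp K a x c n := by
  simp [adExp, smul_comm k]

variable [CharZero K]

/-- The factorials turn multiplication by `ad x` into a weighted shift of `n`: the coefficient form
of the differential equation of the series under `x ↦ t x`. -/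
theorem lie_adExp (a : ℕ) (x c : C) (n : ℕ) :
    ⁅x, adExp K a x c n⁆ = ((n : K) + 1 + a) • adExp K a x c (n + 1) := by
  have h : ((n : K) + 1 + a) * ((n + 1 + a).factorial : K)⁻¹ = ((n + a).factorial : K)⁻¹ := by
    rw [show n + 1 + a = n + a + 1 by ring, Nat.factorial_succ]
    have : ((n : K) + a + 1) ≠ 0 := by exact_mod_cast (n + a).succ_ne_zero
    have : ((n + a).factorial : K) ≠ 0 := by exact_mod_cast (n + a).factorial_ne_zero
    push_cast
    field_simp
    ring
  rw [adExp, adExp, smul_smul, h, pow_succ']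
  simp

/-- The recursion of the Cauchy products of two series of the form `adExp`. -/
theorem smul_sum_lie_adExp (a b : ℕ) (x c d : C) (n : ℕ) :
    ((n : K) + 1 + a + b) •
        ∑ q ∈ antidiagonal (n + 1), ⁅adExp K a x c q.1, adExp K b x d q.2⁆ =
      ⁅x, ∑ q ∈ antidiagonal n, ⁅adExp K a x c q.1, adExp K b x d q.2⁆⁆ +
        ((a : K) • ⁅adExp K a x c 0, adExp K b x d (n + 1)⁆ +
          (b : K) • ⁅adExp K a x c (n + 1), adExp K b x d 0⁆) := by
  have h : ((n : K) + 1 + a + b) •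
        ∑ q ∈ antidiagonal (n + 1), ⁅adExp K a x c q.1, adExp K b x d q.2⁆ =
      ∑ q ∈ antidiagonal (n + 1), ((q.1 : K) + a) • ⁅adExp K a x c q.1, adExp K b x d q.2⁆ +
        ∑ q ∈ antidiagonal (n + 1), ((q.2 : K) + b) • ⁅adExp K a x c q.1, adExp K b x d q.2⁆ := by
    -- On the antidiagonal of `n + 1` the weight splits as `(q.1 + a) + (q.2 + b)`, one part for
    -- each factor of the bracket.
    rw [Finset.smul_sum, ← Finset.sum_add_distrib]
    refine Finset.sum_congr rfl fun q hq => ?_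
    rw [← add_smul]
    congr 1
    have : (q.1 : K) + q.2 = n + 1 := by exact_mod_cast mem_antidiagonal.mp hq
    linear_combination -this
  -- By `lie_adExp` and the Leibniz rule the weighted terms of positive index make up `ad x` of the
  -- previous Cauchy product; the terms of index `0`, of weights `a` and `b`, are the boundary
  -- terms.
  rw [h, Finset.Nat.sum_antidiagonal_succ,
    Finset.Nat.sum_antidiagonal_succ' (f := fun q : ℕ × ℕ => ((q.2 : K) + b) • _)]
  simp only [lie_sum, leibniz_lie x, lie_adExp, Finset.sum_add_distrib, smul_lie, lie_smul]
  push_cast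
  simp only [zero_add]
  abel

/-- Both sides obey the same recursion: for `a = 1`, `b = 0` the only boundary term is `⁅v, R ^ (n +
1) c⁆ / (n + 1)!`, which is the inhomogeneous term in the recursion of `adPowDeriv`. This is the
derivative of `e ^ (ad x) c`. -/
theorem adPowDeriv_adExp_zero (x v c : C) (n : ℕ) :
    ((n + 1).factorial : K)⁻¹ • adPowDeriv K x v c (n + 1) =
      ∑ q ∈ antidiagonal n, ⁅adExp K 1 x v q.1, adExp K 0 x c q.2⁆ := by
  induction n with
  | zero => simp [adPowDeriv, adExp]
  | succ n ih =>
    have h0 : (n : K) + 1 + (1 : ℕ) + (0 : ℕ) ≠ 0 := by exact_mod_cast (n + 1).succ_ne_zero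
    apply smul_right_injective C h0
    dsimp only
    rw [smul_sum_lie_adExp, ← ih, adPowDeriv, smul_smul]
    have h : ((n : K) + 1 + (1 : ℕ) + (0 : ℕ)) * ((n + 1 + 1).factorial : K)⁻¹ =
        ((n + 1).factorial : K)⁻¹ := by
      rw [Nat.factorial_succ (n + 1)]
      push_cast at h0 ⊢
      rw [add_zero] at h0 ⊢
      rw [mul_inv, mul_inv_cancel_left₀ h0]
    rw [h]
    simp [adExp, add_comm]

/-- The Maurer–Cartan equation for `v ↦ ((e ^ (ad x) - 1) / ad x) v`. -/
theorem adPowDeriv_sub_adPowDeriv (x v w : C) (n : ℕ) :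
    ((n + 1 + 1).factorial : K)⁻¹ • adPowDeriv K x v w (n + 1) -
        ((n + 1 + 1).factorial : K)⁻¹ • adPowDeriv K x w v (n + 1) =
      ∑ q ∈ antidiagonal n, ⁅adExp K 1 x v q.1, adExp K 1 x w q.2⁆ := by
  induction n with
  | zero =>
    rw [← smul_sub]
    have h : ⁅v, w⁆ - ⁅w, v⁆ = (2 : K) • ⁅v, w⁆ := by
      rw [← lie_skew w v, two_smul, sub_neg_eq_add]
    simp [adPowDeriv, adExp, h, smul_smul]
  | succ n ih =>
    have h0 : (n : K) + 1 + (1 : ℕ) + (1 : ℕ) ≠ 0 := by exact_mod_cast (n + 2).succ_ne_zero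
    apply smul_right_injective C h0
    dsimp only
    -- For `a = b = 1` both boundary terms survive, one for each of the two derivatives. Only the
    -- derivatives of index `n + 2` are unfolded; those of index `n + 1` come from `ih`.
    rw [smul_sum_lie_adExp, ← ih, ← smul_sub, smul_smul,
      adPowDeriv.eq_2 K x v w (n + 1), adPowDeriv.eq_2 K x w v (n + 1)]
    have h : ((n : K) + 1 + (1 : ℕ) + (1 : ℕ)) * ((n + 1 + 1 + 1).factorial : K)⁻¹ =
        ((n + 1 + 1).factorial : K)⁻¹ := by
      rw [Nat.factorial_succ (n + 1 + 1)]
      push_cast at h0 ⊢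
      rw [mul_inv, mul_inv_cancel_left₀ h0]
    rw [h]
    simp only [adExp, smul_sub, smul_add, lie_sub, lie_smul, smul_lie,
      ← lie_skew w (((LieAlgebra.ad K C x) ^ (n + 1)) v), smul_neg]
    simp
    abel

/-- `e ^ (ad x)` is an automorphism since `ad x` is a derivation; for `a = b = 0` the recursion has
no boundary terms. -/
theorem adExp_zero_lie (x c d : C) (n : ℕ) :
    adExp K 0 x ⁅c, d⁆ n =
      ∑ q ∈ antidiagonal n, ⁅adExp K 0 x c q.1, adExp K 0 x d q.2⁆ := by
  induction n with
  | zero => simp [adExp]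
  | succ n ih =>
    have h0 : (n : K) + 1 + (0 : ℕ) + (0 : ℕ) ≠ 0 := by exact_mod_cast n.succ_ne_zero
    apply smul_right_injective C h0
    dsimp only
    rw [smul_sum_lie_adExp, ← ih, lie_adExp]
    simp

end AdExp

/-! ### Change of coefficients in formal series. -/

section MapSeries

variable {K E F G : Type*} [Field K] [AddCommGroup E] [Module K E] [AddCommGroup F] [Module K F]
  [AddCommGroup G] [Module K G]

/-- The map `F[[E]] → G[[E]]` induced by a linear map `F → G`. -/
def FormalSeries.map (φ : F →ₗ[K] G) (f : FormalSeries K E F) : FormalSeries K E G := fun m =>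
  ⟨fun x => φ ((f m).1 x), by
    obtain ⟨u, hu⟩ := (f m).2
    exact ⟨φ.compMultilinearMap u, fun x => by simp [hu]⟩⟩

@[simp] theorem FormalSeries.map_coe (φ : F →ₗ[K] G) (f : FormalSeries K E F) (m : ℕ) (x : E) :
    ((f.map φ) m).1 x = φ ((f m).1 x) := rfl

theorem FormalSeries.map_injective {φ : F →ₗ[K] G} (hφ : Function.Injective φ) :
    Function.Injective (FormalSeries.map (E := E) φ) := fun _ _ h =>
  FormalSeries.ext fun m x => hφ (congrArg (fun k => (k m).1 x) h)

theorem FormalSeries.map_add (φ : F →ₗ[K] G) (f g : FormalSeries K E F) :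
    (f + g).map φ = f.map φ + g.map φ := FormalSeries.ext fun m x => by simp

theorem FormalSeries.map_sub (φ : F →ₗ[K] G) (f g : FormalSeries K E F) :
    (f - g).map φ = f.map φ - g.map φ := FormalSeries.ext fun m x => by simp

theorem FormalSeries.map_smul (φ : F →ₗ[K] G) (a : K) (f : FormalSeries K E F) :
    (a • f).map φ = a • f.map φ := FormalSeries.ext fun m x => by simp

theorem seriesDeriv_sub_right [Infinite K] (ξ : FormalSeries K E E) (f g : FormalSeries K E F) :
    seriesDeriv ξ (f - g) = seriesDeriv ξ f - seriesDeriv ξ g := by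
  rw [eq_sub_iff_add_eq, ← seriesDeriv_add_right, sub_add_cancel]

theorem FormalSeries.map_seriesDeriv [Infinite K] (φ : F →ₗ[K] G) (ξ : FormalSeries K E E)
    (f : FormalSeries K E F) : (seriesDeriv ξ f).map φ = seriesDeriv ξ (f.map φ) :=
  FormalSeries.ext fun m x => by
    simp only [FormalSeries.map_coe, seriesDeriv_coe, map_sum]
    exact Finset.sum_congr rfl fun p _ =>
      (dirDeriv_eq_of_curve ((curve_dirDeriv (f p.2) x _).linear φ)).symm

theorem FormalSeries.map_lie {A C : Type*} [LieRing A] [LieAlgebra K A] [LieRing C]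
    [LieAlgebra K C] (φ : A →ₗ⁅K⁆ C) (f g : FormalSeries K E A) :
    (⁅f, g⁆ : FormalSeries K E A).map (φ : A →ₗ[K] C) =
      ⁅f.map (φ : A →ₗ[K] C), g.map (φ : A →ₗ[K] C)⁆ :=
  FormalSeries.ext fun m x => by simp [lie_coe]

end MapSeries

/-! ### The exponential, its logarithmic derivative and the Maurer–Cartan equation. -/

section Exponential

variable {K B C : Type*} [Field K] [AddCommGroup B] [Module K B] [LieRing C] [LieAlgebra K C]

theorem adExp_mem (a : ℕ) (s : B →ₗ[K] C) {f : B → C} {r : ℕ} (hf : f ∈ HomPoly K B C r) (n : ℕ) :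
    (fun y => adExp K a (s y) (f y) n) ∈ HomPoly K B C (n + r) := by
  refine Submodule.smul_mem _ _ (x := fun y => ((LieAlgebra.ad K C (s y)) ^ n) (f y)) ?_
  induction n with
  | zero => simpa using hf
  | succ n ih =>
    have := lie_mem (linear_mem s) ih
    rw [← add_assoc, add_comm 1] at this
    simpa [pow_succ'] using this

/-- The series `y ↦ e ^ (ad (s y)) c`. -/
noncomputable def expSeries (s : B →ₗ[K] C) (c : C) : FormalSeries K B C := fun n =>
  ⟨fun y => adExp K 0 (s y) c n, adExp_mem 0 s (const_mem c) n⟩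

theorem expSeries_coe (s : B →ₗ[K] C) (c : C) (n : ℕ) (y : B) :
    (expSeries s c n).1 y = adExp K 0 (s y) c n := rfl

/-- The series `y ↦ ((e ^ R - 1) / R) (s (ξ y))`, where `R = ad (s y)`. -/
noncomputable def maurerCartan (s : B →ₗ[K] C) (ξ : FormalSeries K B B) : FormalSeries K B C :=
  fun m => ⟨fun y => ∑ q ∈ antidiagonal m, adExp K 1 (s y) (s ((ξ q.2).1 y)) q.1, by
    have := Submodule.sum_mem (HomPoly K B C m)
      (f := fun q : ℕ × ℕ => fun y => adExp K 1 (s y) (s ((ξ q.2).1 y)) q.1)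
      (fun q (hq : q ∈ antidiagonal m) => mem_antidiagonal.mp hq ▸
        adExp_mem 1 s (ξ.map s q.2).2 q.1)
    refine (congrArg (· ∈ HomPoly K B C m) ?_).mp this
    funext x
    simp⟩

theorem maurerCartan_coe (s : B →ₗ[K] C) (ξ : FormalSeries K B B) (m : ℕ) (y : B) :
    (maurerCartan s ξ m).1 y =
      ∑ q ∈ antidiagonal m, adExp K 1 (s y) (s ((ξ q.2).1 y)) q.1 := rfl

theorem maurerCartan_add (s : B →ₗ[K] C) (ξ η : FormalSeries K B B) :
    maurerCartan s (ξ + η) = maurerCartan s ξ + maurerCartan s η :=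
  FormalSeries.ext fun m y => by
    simp [maurerCartan_coe, adExp_add, Finset.sum_add_distrib]

theorem maurerCartan_smul (s : B →ₗ[K] C) (a : K) (ξ : FormalSeries K B B) :
    maurerCartan s (a • ξ) = a • maurerCartan s ξ :=
  FormalSeries.ext fun m y => by
    simp [maurerCartan_coe, adExp_smul, Finset.smul_sum]

theorem maurerCartan_sub (s : B →ₗ[K] C) (ξ η : FormalSeries K B B) :
    maurerCartan s (ξ - η) = maurerCartan s ξ - maurerCartan s η := by
  rw [eq_sub_iff_add_eq, ← maurerCartan_add, sub_add_cancel]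

variable [CharZero K]

theorem expSeries_lie (s : B →ₗ[K] C) (c d : C) :
    expSeries s ⁅c, d⁆ = ⁅expSeries s c, expSeries s d⁆ :=
  FormalSeries.ext fun m y => adExp_zero_lie (s y) c d m

theorem dirDeriv_expSeries (s : B →ₗ[K] C) (c : C) (n : ℕ) (y v : B) :
    dirDeriv (expSeries s c n) y v = ((n.factorial : K))⁻¹ • adPowDeriv K (s y) (s v) c n := by
  refine dirDeriv_eq_of_curve (a := adExp K 0 (s y) c n) ?_
  -- The direction `0` keeps the vector `c` fixed.
  refine (Curve.adExp 0 ((Curve.line y v).linear s) (Curve.line c (0 : C)) n).congr ?_ rfl ?_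
  · funext t; simp [expSeries_coe]
  · simp [adExp]

/-- The derivative of the exponential: `ξ . e ^ R c = [((e ^ R - 1) / R) s ξ, e ^ R c]`. -/
theorem seriesDeriv_expSeries (s : B →ₗ[K] C) (c : C) (ξ : FormalSeries K B B) :
    seriesDeriv ξ (expSeries s c) = ⁅maurerCartan s ξ, expSeries s c⁆ := by
  refine FormalSeries.ext fun m y => ?_
  simp only [seriesDeriv_coe, lie_coe, maurerCartan_coe, expSeries_coe, sum_lie,
    dirDeriv_expSeries]
  -- The split-off term differentiates the constant component and is `0`; the other terms have the
  -- index `n + 1` required by `adPowDeriv_adExp_zero`.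
  rw [Finset.Nat.sum_antidiagonal_succ']
  simp only [adPowDeriv_adExp_zero]
  rw [← sum_assoc m fun a b e => ⁅adExp K 1 (s y) (s ((ξ b).1 y)) a, adExp K 0 (s y) c e⁆,
    sum_swap m fun a b e => ⁅adExp K 1 (s y) (s ((ξ b).1 y)) a, adExp K 0 (s y) c e⁆]
  simp [adPowDeriv]

theorem dirDeriv_maurerCartan (s : B →ₗ[K] C) (ξ : FormalSeries K B B) (m : ℕ) (y v : B) :
    dirDeriv (maurerCartan s ξ m) y v = ∑ q ∈ antidiagonal m,
      (((q.1 + 1).factorial : K)⁻¹ • adPowDeriv K (s y) (s v) (s ((ξ q.2).1 y)) q.1 +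
        adExp K 1 (s y) (s (dirDeriv (ξ q.2) y v)) q.1) := by
  refine dirDeriv_eq_of_curve (Curve.sum _ fun q _ =>
    (Curve.adExp 1 ((Curve.line y v).linear s) ((curve_dirDeriv (ξ q.2) y v).linear s) q.1).congr
      ?_ rfl rfl)
  funext t; simp

/-- Product rule: the first sum differentiates the operator `(e ^ R - 1) / R`, the second term its
argument `s η`. Antisymmetrizing the first sum in `ξ`, `η` will produce the bracket. -/
theorem seriesDeriv_maurerCartan (s : B →ₗ[K] C) (ξ η : FormalSeries K B B) (m : ℕ) (y : B) :
    (seriesDeriv ξ (maurerCartan s η) m).1 y =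
      ∑ p ∈ antidiagonal m, ∑ q ∈ antidiagonal p.2, ((q.1 + 1 + 1).factorial : K)⁻¹ •
        adPowDeriv K (s y) (s ((ξ p.1).1 y)) (s ((η q.2).1 y)) (q.1 + 1) +
      (maurerCartan s (seriesDeriv ξ η) m).1 y := by
  simp only [seriesDeriv_coe, dirDeriv_maurerCartan, Finset.sum_add_distrib]
  congr 1
  · exact sum_middle_succ m (fun a b c => ((b + 1).factorial : K)⁻¹ •
      adPowDeriv K (s y) (s ((ξ a).1 y)) (s ((η c).1 y)) b) (by simp [adPowDeriv])
  · simp only [maurerCartan_coe, seriesDeriv_coe, map_sum, adExp_sum]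
    rw [sum_shift m (fun a b c => adExp K 1 (s y) (s (dirDeriv (η c) y ((ξ b).1 y))) a)
      (by simp [dirDeriv_zero_deg, adExp])]
    exact sum_swap (m + 1) fun a b c => adExp K 1 (s y) (s (dirDeriv (η c) y ((ξ a).1 y))) b

/-- The Maurer–Cartan equation for the logarithmic derivative of the exponential. -/
theorem seriesDeriv_maurerCartan_sub (s : B →ₗ[K] C) (ξ η : FormalSeries K B B) :
    seriesDeriv ξ (maurerCartan s η) - seriesDeriv η (maurerCartan s ξ) =
      ⁅maurerCartan s ξ, maurerCartan s η⁆ +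
        (maurerCartan s (seriesDeriv ξ η) - maurerCartan s (seriesDeriv η ξ)) := by
  refine FormalSeries.ext fun m y => ?_
  simp only [FormalSeries.sub_coe, FormalSeries.add_coe, seriesDeriv_maurerCartan]
  rw [add_sub_add_comm]
  congr 1
  -- Gives `ξ` and `η` the same indices in both sums, so that the difference can be taken term by
  -- term.
  rw [sum_swap_outer m fun a b c => ((b + 1 + 1).factorial : K)⁻¹ •
    adPowDeriv K (s y) (s ((η a).1 y)) (s ((ξ c).1 y)) (b + 1)]
  simp only [← Finset.sum_sub_distrib, adPowDeriv_sub_adPowDeriv]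
  simp only [lie_coe, maurerCartan_coe, sum_lie]
  simp only [lie_sum]
  exact sum_assoc_four m fun a b c d =>
    ⁅adExp K 1 (s y) (s ((ξ b).1 y)) a, adExp K 1 (s y) (s ((η d).1 y)) c⁆

end Exponential

/-! ### The series `h_c` in `C[[B]]`. -/

section Embedding

variable {K B C : Type*} [Field K] [LieRing B] [LieAlgebra K B] [LieRing C] [LieAlgebra K C]

theorem map_ad_pow (p : C →ₗ⁅K⁆ B) (s : B →ₗ[K] C) (hs : ∀ b, p (s b) = b) (c : C) (y : B)
    (n : ℕ) : p (((LieAlgebra.ad K C (s y)) ^ n) c) = ((LieAlgebra.ad K B y) ^ n) (p c) := by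
  induction n with
  | zero => simp
  | succ n ih => simp [pow_succ', ih, hs]

variable [CharZero K]

/-- The series `e ^ R c - ((e ^ R - 1) / R) s d_{p c}` of `C[[B]]`. -/
noncomputable def reprSeries (p : C →ₗ⁅K⁆ B) (s : B →ₗ[K] C) (c : C) : FormalSeries K B C :=
  expSeries s c - maurerCartan s (fundamentalSeries (p c))

theorem reprSeries_coe (p : C →ₗ⁅K⁆ B) (s : B →ₗ[K] C) (hs : ∀ b, p (s b) = b) (c : C) (m : ℕ)
    (y : B) : (reprSeries p s c m).1 y = reprComponent p s c m y := by
  rw [reprSeries, FormalSeries.sub_coe, expSeries_coe, maurerCartan_coe, reprComponent]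
  congr 1
  · simp [adExp]
  · refine Finset.sum_congr rfl fun q _ => ?_
    rw [fundamentalSeries_coe, map_smul, adExp_smul, map_ad_pow p s hs, adExp, smul_smul,
      div_eq_mul_inv]

/-- Coefficient of `T ^ (m + 1)` in `G(T) (e ^ T - 1) = T e ^ T`; the term of `e ^ T - 1` in degree
`0` drops out. -/
theorem sum_tCoeff_div_factorial (m : ℕ) :
    ∑ q ∈ antidiagonal m, tCoeff K q.2 / ((q.1 + 1).factorial : K) = 1 / (m.factorial : K) := by
  have h := congrArg (PowerSeries.coeff (m + 1)) (tCoeff_spec K)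
  rw [PowerSeries.coeff_mul, Finset.Nat.sum_antidiagonal_succ', PowerSeries.coeff_succ_X_mul,
    ← Finset.Nat.sum_antidiagonal_swap] at h
  simpa [PowerSeries.coeff_exp, PowerSeries.coeff_one, div_eq_mul_inv] using h

/-- Under `p` every term becomes a multiple of `(ad y) ^ m (p c)`, and the scalars cancel by
`sum_tCoeff_div_factorial`. -/
theorem map_reprComponent (p : C →ₗ⁅K⁆ B) (s : B →ₗ[K] C) (hs : ∀ b, p (s b) = b) (c : C) (m : ℕ)
    (y : B) : p (reprComponent p s c m y) = 0 := by
  have h : ∀ q ∈ antidiagonal m, p ((tCoeff K q.2 / ((q.1 + 1).factorial : K)) •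
      ((LieAlgebra.ad K C (s y)) ^ q.1) (s (p (((LieAlgebra.ad K C (s y)) ^ q.2) c)))) =
      (tCoeff K q.2 / ((q.1 + 1).factorial : K)) • ((LieAlgebra.ad K B y) ^ m) (p c) := by
    intro q hq
    rw [map_smul, map_ad_pow p s hs, hs, map_ad_pow p s hs, ← mem_antidiagonal.mp hq, pow_add]
    rfl
  rw [reprComponent, map_sub, map_sum, Finset.sum_congr rfl h, ← Finset.sum_smul,
    sum_tCoeff_div_factorial, map_smul, map_ad_pow p s hs, sub_self]

theorem reprComponent_zero_of_map_eq_zero (p : C →ₗ⁅K⁆ B) (s : B →ₗ[K] C) {c : C} (hc : p c = 0)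
    (y : B) : reprComponent p s c 0 y = c := by
  simp [reprComponent, hc]

theorem reprSeries_add (p : C →ₗ⁅K⁆ B) (s : B →ₗ[K] C) (c d : C) :
    reprSeries p s (c + d) = reprSeries p s c + reprSeries p s d := by
  have h1 : expSeries s (c + d) = expSeries s c + expSeries s d :=
    FormalSeries.ext fun m y => adExp_add 0 (s y) c d m
  have h2 : (fundamentalSeries (p c + p d) : FormalSeries K B B) =
      fundamentalSeries (p c) + fundamentalSeries (p d) :=
    FormalSeries.ext fun m y => by simp [fundamentalSeries_coe]
  rw [reprSeries, h1, map_add, h2, maurerCartan_add, add_sub_add_comm]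
  rfl

theorem reprSeries_smul (p : C →ₗ⁅K⁆ B) (s : B →ₗ[K] C) (a : K) (c : C) :
    reprSeries p s (a • c) = a • reprSeries p s c := by
  have h1 : expSeries s (a • c) = a • expSeries s c :=
    FormalSeries.ext fun m y => adExp_smul 0 (s y) c a m
  have h2 : (fundamentalSeries (a • p c) : FormalSeries K B B) = a • fundamentalSeries (p c) :=
    FormalSeries.ext fun m y => by simp [fundamentalSeries_coe, smul_comm a]
  rw [reprSeries, h1, map_smul, h2, maurerCartan_smul, ← smul_sub]
  rfl

/-- In the expansion, the brackets of `E` with `ω` cancel against the derivatives of `E`, and the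
Maurer–Cartan equation turns the remaining terms in `ω` into `- ω (d_{[p c, p d]})`. -/
theorem reprSeries_lie (p : C →ₗ⁅K⁆ B) (s : B →ₗ[K] C) (c d : C) :
    reprSeries p s ⁅c, d⁆ = ⁅reprSeries p s c, reprSeries p s d⁆ +
      seriesDeriv (fundamentalSeries (p c)) (reprSeries p s d) -
        seriesDeriv (fundamentalSeries (p d)) (reprSeries p s c) := by
  have h := seriesDeriv_maurerCartan_sub s (fundamentalSeries (p c)) (fundamentalSeries (p d))
  simp only [reprSeries, seriesDeriv_sub_right, seriesDeriv_expSeries, expSeries_lie,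
    LieHom.map_lie, fundamentalSeries_lie, maurerCartan_sub, lie_sub, sub_lie]
  rw [sub_eq_iff_eq_add] at h
  rw [h, ← lie_skew (expSeries s c) (maurerCartan s (fundamentalSeries (p d)))]
  abel

end Embedding

end Entrelacement

/-! ### Descent from `C[[B]]` to `A[[B]]` and the embedding. -/

theorem mainTheorem1 {K A B C : Type*} [Field K] [CharZero K] [LieRing A] [LieAlgebra K A]
    [LieRing B] [LieAlgebra K B] [LieRing C] [LieAlgebra K C]
    (i : A →ₗ⁅K⁆ C) (p : C →ₗ⁅K⁆ B) (hext : LieAlgebra.IsExtension i p)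
    (s : B →ₗ[K] C) (hs : ∀ b, p (s b) = b) :
    ∃ f : C →ₗ⁅K⁆ Entrelacement.Wreath K A B,
      (∀ c, (f c).right = p c) ∧
      (∀ c m y, i (((f c).left m).1 y) = Entrelacement.reprComponent p s c m y) ∧
      Function.Injective f := by
  open Entrelacement in
  have hi : Function.Injective (i : A →ₗ[K] C) := (LieHom.ker_eq_bot i).mp hext.ker_eq_bot
  -- A linear retraction of `C` onto `A` carries `h_c` into `A[[B]]`: composition with `q` preserves
  -- homogeneous polynomials, and nothing is lost since the values of `h_c` lie in the kernel of
  -- `p`.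
  obtain ⟨q, hq⟩ := LinearMap.exists_leftInverse_of_injective (i : A →ₗ[K] C)
    (LinearMap.ker_eq_bot.mpr hi)
  have hiq : ∀ x, p x = 0 → i (q x) = x := by
    intro x hx
    have hx' : x ∈ i.range := by rw [hext.exact]; exact hx
    obtain ⟨a, rfl⟩ := hx'
    exact congrArg i (LinearMap.congr_fun hq a)
  have hmap : ∀ c, ((reprSeries p s c).map q).map (i : A →ₗ[K] C) = reprSeries p s c := fun c =>
    FormalSeries.ext fun m y => hiq _ (by
      rw [reprSeries_coe p s hs, map_reprComponent p s hs])
  have hcoe : ∀ c m y, i ((((reprSeries p s c).map q) m).1 y) = reprComponent p s c m y :=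
    fun c m y => by
      rw [← reprSeries_coe p s hs, ← congrArg (fun g => (g m).1 y) (hmap c)]; rfl
  let f : C →ₗ⁅K⁆ Wreath K A B :=
    { toFun := fun c => ⟨(reprSeries p s c).map q, p c⟩
      map_add' := fun c d => by
        rw [reprSeries_add, FormalSeries.map_add, map_add]; rfl
      map_smul' := fun a c => by
        rw [reprSeries_smul, FormalSeries.map_smul, map_smul]; rfl
      map_lie' := fun {c d} => by
        rw [Wreath.lie_mk, LieHom.map_lie]
        congr 1
        -- `q` need not respect brackets, so the identity is checked in `C[[B]]`, after applying the
        -- injective homomorphism `i`.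
        apply FormalSeries.map_injective hi
        rw [hmap, reprSeries_lie, FormalSeries.map_sub, FormalSeries.map_add,
          FormalSeries.map_lie, FormalSeries.map_seriesDeriv, FormalSeries.map_seriesDeriv,
          hmap, hmap] }
  refine ⟨f, fun c => rfl, hcoe, ?_⟩
  rw [injective_iff_map_eq_zero]
  intro c hc
  have hpc : p c = 0 := congrArg LieAlgebra.SemiDirectSum.right hc
  have h0 : (reprSeries p s c).map q = 0 := congrArg LieAlgebra.SemiDirectSum.left hc
  -- The component of degree `0` recovers `c`; it is constant in `y`, so the point `0` serves as
  -- well as any other.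
  rw [← reprComponent_zero_of_map_eq_zero p s hpc 0, ← hcoe, h0]
  exact map_zero i
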